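/- Let $G$ be a finite simple graph. For a graph $F$, say that a set $D\subseteq V(F)$ is dominating in $F$ if every vertex of $V(F)\setminus D$ is adjacent to some vertex of $D$. A split graph is a graph whose vertex set can be partitioned into a stable set and a clique (one of which may be empty), and $F$ is dominated by an induced connected split graph if some dominating set $D$ of $F$ induces a connected split graph $F[D]$. (Connected graphs are non-empty.) A graph is $L$-free if it has no induced subgraph isomorphic to $L$. Attaching a leaf to a vertex $u$ means adding a new vertex $u'$ and the single edge $uu'$. Let $P_7$ be the chordless path and $C_7$ the chordless cycle on $7$ vertices. Let $H_1$ be the graph with vertices $a,b,c,d,e$ and edges $ab,bc,ca,ad,de$, and let $H_2$ be obtained from $H_1$ by adding the edge $ae$. Let $Q_1$ be the graph obtained from the cycle $C_5$ by attaching a leaf to each of its five vertices; $Q_2$ the graph obtained from the cycle $C_4$ by attaching a leaf to each of its four vertices; $Q_3$ the graph obtained from $H_1$ by attaching a leaf to each of its non-cut vertices $b,c,e$; and $Q_4$ the graph obtained from $H_2$ by attaching a leaf to each of its non-cut vertices $b,c,d,e$. Then every connected induced subgraph of $G$ is dominated by an induced connected split graph if and only if $G$ is $P_7$-free, $C_7$-free,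 $Q_1$-free, $Q_2$-free, $Q_3$-free and $Q_4$-free. -/

import Mathlib

namespace SplitDomination

variable {V W : Type*}

/-- A set `D` of vertices is dominating if every vertex outside `D` has a neighbour in `D`. -/
def IsDominating (G : SimpleGraph V) (D : Set V) : Prop :=
  ∀ v, v ∉ D → ∃ d ∈ D, G.Adj v d

/-- A split graph: the vertex set can be partitioned into a stable set and a clique
(either part may be empty). -/
def IsSplit (G : SimpleGraph V) : Prop :=
  ∃ S K : Set V, Disjoint S K ∧ S ∪ K = Set.univ ∧ G.IsIndepSet S ∧ G.IsClique K

/-- `G` is dominated by an induced connected split graph: some dominating set of `G` induces a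
connected split graph. -/
def DominatedByConnectedSplit (G : SimpleGraph V) : Prop :=
  ∃ D : Set V, IsDominating G D ∧ (G.induce D).Connected ∧ IsSplit (G.induce D)

/-- `G` is `H`-free: no induced subgraph of `G` is isomorphic to `H`. -/
def IsFree (G : SimpleGraph V) (H : SimpleGraph W) : Prop :=
  ¬ H.IsIndContained G

/-- The adjacency of the graph obtained from `H` by attaching one leaf `Sum.inr u` to each
vertex `u ∈ L`. -/
def LeafAdj (H : SimpleGraph V) (L : Set V) : V ⊕ L → V ⊕ L → Prop
  | Sum.inl u, Sum.inl v => H.Adj u v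
  | Sum.inl u, Sum.inr v => u = v
  | Sum.inr u, Sum.inl v => u = v
  | Sum.inr _, Sum.inr _ => False

/-- The graph obtained from `H` by attaching one leaf to each vertex of `L`. -/
def attachLeaves (H : SimpleGraph V) (L : Set V) : SimpleGraph (V ⊕ L) where
  Adj := LeafAdj H L
  symm := ⟨by
    rintro (u | u) (v | v) h
    · exact SimpleGraph.Adj.symm h
    · exact Eq.symm h
    · exact Eq.symm h
    · exact h⟩
  loopless := ⟨by
    rintro (u | u) h
    · exact H.irrefl h
    · exact h⟩

/-- The paw on `a, b, c, d = 0, 1, 2, 3` (edges `ab, bc, ca, ad`) together with a vertex `e = 4`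
and the edge `de`. -/
def H1 : SimpleGraph (Fin 5) :=
  SimpleGraph.fromEdgeSet {s(0, 1), s(1, 2), s(2, 0), s(0, 3), s(3, 4)}

/-- `H1` together with the edge `ae`: two triangles sharing the vertex `a = 0`. -/
def H2 : SimpleGraph (Fin 5) :=
  SimpleGraph.fromEdgeSet {s(0, 1), s(1, 2), s(2, 0), s(0, 3), s(3, 4), s(0, 4)}

/-- The cycle `C₅` with a leaf attached to each vertex. -/
def Q1 : SimpleGraph (Fin 5 ⊕ (Set.univ : Set (Fin 5))) :=
  attachLeaves (SimpleGraph.cycleGraph 5) Set.univ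

/-- The cycle `C₄` with a leaf attached to each vertex. -/
def Q2 : SimpleGraph (Fin 4 ⊕ (Set.univ : Set (Fin 4))) :=
  attachLeaves (SimpleGraph.cycleGraph 4) Set.univ

/-- `H1` with a leaf attached to each of its non-cut vertices `b, c, e`. -/
def Q3 : SimpleGraph (Fin 5 ⊕ ({1, 2, 4} : Set (Fin 5))) :=
  attachLeaves H1 {1, 2, 4}

/-- `H2` with a leaf attached to each of its non-cut vertices `b, c, d, e`. -/
def Q4 : SimpleGraph (Fin 5 ⊕ ({1, 2, 3, 4} : Set (Fin 5))) :=
  attachLeaves H2 {1, 2, 3, 4}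

/-- `G` is `(P₇, C₇, Q₁, Q₂, Q₃, Q₄)`-free. -/
def IsCFree (G : SimpleGraph V) : Prop :=
  IsFree G (SimpleGraph.pathGraph 7) ∧ IsFree G (SimpleGraph.cycleGraph 7) ∧
    IsFree G Q1 ∧ IsFree G Q2 ∧ IsFree G Q3 ∧ IsFree G Q4

end SplitDomination

namespace SplitDomination

variable {V W : Type*}

/-! Freeness passes to induced subgraphs, so for sufficiency it is enough to treat a connected free
graph `G`. Take a connected dominating set `Y` that minimises |E| - |V| of `G[Y]`, and then |Y|.

Suppose `Y` contains an induced copy of `H` and `H - x` is connected. Then the copy of `x` acquires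
a leaf. If it is a cut vertex of `G[Y]`, the leaf is a neighbour of it on a side of the cut that
misses the rest of the copy. Otherwise deleting it keeps `Y` connected, so by minimality domination
fails and it has a private neighbour outside `Y`. Leaves can be made pairwise nonadjacent: replace a
vertex of degree at least two by the private leaves already chosen. These are pendant, so |E| - |V|
drops; the new set is connected, hence does not dominate, and a vertex it misses is a leaf
nonadjacent to the earlier ones (`IsOptimal.exists_isPrivate`,
`IsOptimal.attachLeaves_isIndContained`).

So C₅, C₄, `H1`, `H2` inside `Y` would grow to `Q1`, `Q2`, `Q3`, `Q4`, and P₅ to P₇ or C₇. A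
connected graph without P₅, `H1`, `H2` has no 2K₂, and a graph without 2K₂, C₄, C₅ is split
(`isSplit_of_forbidden`).

Conversely, each of the six graphs is connected, and domination together with the absence of
isolated vertices forces a 2K₂, C₄ or C₅ inside any candidate set. -/

/-! ### Connectivity through cuts. -/

/-- Connectivity of the induced subgraph on `s`, in terms of cuts. -/
def ConnOn (G : SimpleGraph V) (s : Set V) : Prop :=
  s.Nonempty ∧ ∀ A ⊆ s, A.Nonempty → (s \ A).Nonempty → ∃ a ∈ A, ∃ b ∈ s \ A, G.Adj a b

theorem connOn_iff {G : SimpleGraph V} {s : Set V} :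
    ConnOn G s ↔ (G.induce s).Connected := by
  constructor
  · rintro ⟨⟨x, hx⟩, h⟩
    rw [SimpleGraph.connected_iff_exists_forall_reachable]
    refine ⟨⟨x, hx⟩, fun y => ?_⟩
    by_contra hy
    obtain ⟨a, ⟨ha, hra⟩, b, ⟨hb, hnb⟩, hab⟩ :=
      h {v | ∃ hv : v ∈ s, (G.induce s).Reachable ⟨x, hx⟩ ⟨v, hv⟩} (fun v hv => hv.1)
        ⟨x, hx, SimpleGraph.Reachable.refl _⟩ ⟨y.1, y.2, fun hv => hy hv.2⟩
    refine hnb ⟨hb, hra.trans (SimpleGraph.Adj.reachable ?_)⟩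
    exact hab
  · intro h
    obtain ⟨x⟩ := h.nonempty
    refine ⟨⟨x.1, x.2⟩, ?_⟩
    rintro A hA ⟨a, ha⟩ ⟨b, hb, hbA⟩
    obtain ⟨p⟩ := h.preconnected ⟨a, hA ha⟩ ⟨b, hb⟩
    obtain ⟨d, -, h1, h2⟩ := p.exists_boundary_dart {v | v.1 ∈ A} ha hbA
    exact ⟨d.fst.1, h1, d.snd.1, ⟨d.snd.2, h2⟩, d.adj⟩

theorem ConnOn.exists_adj {G : SimpleGraph V} {s : Set V} (h : ConnOn G s) {x y : V}
    (hx : x ∈ s) (hy : y ∈ s) (hxy : y ≠ x) : ∃ z ∈ s, z ≠ x ∧ G.Adj x z := by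
  obtain ⟨a, rfl, b, ⟨hb, hba⟩, hab⟩ := h.2 {x} (by simpa using hx) ⟨x, rfl⟩ ⟨y, hy, hxy⟩
  exact ⟨b, hb, hba, hab⟩

theorem ConnOn.insert {G : SimpleGraph V} {s : Set V} (h : ConnOn G s) {w z : V}
    (hz : z ∈ s) (hwz : G.Adj w z) : ConnOn G (insert w s) := by
  refine ⟨⟨w, Or.inl rfl⟩, ?_⟩
  rintro A hA hne ⟨b, hb, hbA⟩
  by_cases h1 : (A ∩ s).Nonempty
  · by_cases h2 : (s \ (A ∩ s)).Nonempty
    · obtain ⟨a, ha, c, hc, hac⟩ := h.2 (A ∩ s) Set.inter_subset_right h1 h2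
      exact ⟨a, ha.1, c, ⟨Or.inr hc.1, fun hcA => hc.2 ⟨hcA, hc.1⟩⟩, hac⟩
    · have hs : s ⊆ A := fun v hv => by
        by_contra hvA
        exact h2 ⟨v, hv, fun h => hvA h.1⟩
      rcases hb with rfl | hb
      · exact ⟨z, hs hz, b, ⟨Or.inl rfl, hbA⟩, hwz.symm⟩
      · exact absurd (hs hb) hbA
  · obtain ⟨a, ha⟩ := hne
    have haw : a = w := (hA ha).resolve_right fun has => h1 ⟨a, ha, has⟩
    subst haw
    exact ⟨a, ha, z, ⟨Or.inr hz, fun hzA => h1 ⟨z, hzA, hz⟩⟩, hwz⟩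

/-! ### Optimal connected dominating sets and private neighbours. -/

/-- `Y` induces a connected subgraph and dominates the graph. -/
def IsConnDom (G : SimpleGraph V) (Y : Finset V) : Prop :=
  ConnOn G (Y : Set V) ∧ ∀ v, v ∉ Y → ∃ d ∈ Y, G.Adj v d

/-- A vertex outside `Y` whose only neighbour in `Y` is `x`. -/
def IsPrivate (G : SimpleGraph V) (Y : Finset V) (x p : V) : Prop :=
  p ∉ Y ∧ G.Adj x p ∧ ∀ y ∈ Y, G.Adj y p → y = x

section Finite

variable (G : SimpleGraph V) [DecidableRel G.Adj]

open Finset in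
/-- Twice the difference between the numbers of edges and of vertices of the subgraph induced on
`S`. -/
def excess (S : Finset V) : ℤ :=
  ∑ v ∈ S, (#{w ∈ S | G.Adj v w} : ℤ) - 2 * S.card

/-- A connected dominating set that first minimises the excess and then the cardinality. -/
def IsOptimal (Y : Finset V) : Prop :=
  IsConnDom G Y ∧ ∀ Z, IsConnDom G Z → excess G Y ≤ excess G Z ∧
    (excess G Z = excess G Y → Y.card ≤ Z.card)

theorem exists_isOptimal [Finite V] (h : ConnOn G Set.univ) : ∃ Y, IsOptimal G Y := by
  classical
  have := Fintype.ofFinite V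
  have hne : (Finset.univ.filter fun Y : Finset V => IsConnDom G Y).Nonempty :=
    ⟨Finset.univ, Finset.mem_filter.2 ⟨Finset.mem_univ _, by simpa using h, by simp⟩⟩
  obtain ⟨Y, hY, hmin⟩ := Finset.exists_min_image _
    (fun Y => toLex (excess G Y, Y.card)) hne
  refine ⟨Y, (Finset.mem_filter.1 hY).2, fun Z hZ => ?_⟩
  have := hmin Z (Finset.mem_filter.2 ⟨Finset.mem_univ _, hZ⟩)
  rw [Prod.Lex.toLex_le_toLex] at this
  rcases this with h | ⟨h1, h2⟩
  · exact ⟨h.le, fun h' => absurd h' h.ne'⟩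
  · exact ⟨h1.le, fun _ => h2⟩

variable [DecidableEq V]

open Finset in
theorem excess_insert {S : Finset V} {v : V} (hv : v ∉ S) :
    excess G (insert v S) = excess G S + 2 * (#{w ∈ S | G.Adj v w} : ℤ) - 2 := by
  have h1 : ∀ u, #{w ∈ insert v S | G.Adj u w} =
      (if G.Adj u v then 1 else 0) + #{w ∈ S | G.Adj u w} := by
    intro u
    rw [filter_insert]
    split_ifs with h
    · rw [card_insert_of_notMem (by simp [hv])]; ring
    · ring
  have h2 : ∑ u ∈ S, (if G.Adj u v then (1 : ℤ) else 0) = #{w ∈ S | G.Adj v w} := by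
    rw [card_filter]
    push_cast
    exact sum_congr rfl fun u _ => by simp [G.adj_comm u v]
  unfold excess
  simp only [h1]
  rw [sum_insert hv, card_insert_of_notMem hv]
  push_cast
  rw [sum_add_distrib, h2]
  simp
  ring

open Finset in
/-- Attaching pendant vertices preserves connectivity and the excess. -/
theorem connOn_union_excess {S : Finset V} (hS : ConnOn G (S : Set V)) (T : Finset V)
    (hind : ∀ w ∈ T, ∀ w' ∈ T, ¬ G.Adj w w')
    (hdisj : ∀ w ∈ T, w ∉ S)
    (huniq : ∀ w ∈ T, ∃ z ∈ S, G.Adj w z ∧ ∀ z' ∈ S, G.Adj w z' → z' = z) :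
    ConnOn G ((T ∪ S : Finset V) : Set V) ∧ excess G (T ∪ S) = excess G S := by
  induction T using Finset.induction_on with
  | empty => simpa using hS
  | insert w T hw ih =>
    obtain ⟨ih1, ih2⟩ := ih (fun a ha b hb => hind a (mem_insert_of_mem ha) b (mem_insert_of_mem hb))
      (fun a ha => hdisj a (mem_insert_of_mem ha)) (fun a ha => huniq a (mem_insert_of_mem ha))
    obtain ⟨z, hz, hwz, hu⟩ := huniq w (mem_insert_self _ _)
    have hwTS : w ∉ T ∪ S := by
      simp [hw, hdisj w (mem_insert_self _ _)]
    rw [insert_union]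
    refine ⟨?_, ?_⟩
    · rw [coe_insert]
      exact ih1.insert (z := z) (by simp [hz]) hwz
    · have : {u ∈ T ∪ S | G.Adj w u} = {z} := by
        ext u
        simp only [mem_filter, mem_union, mem_singleton]
        constructor
        · rintro ⟨h | h, hwu⟩
          · exact absurd hwu (hind w (mem_insert_self _ _) u (mem_insert_of_mem h))
          · exact hu u h hwu
        · rintro rfl
          exact ⟨Or.inr hz, hwz⟩
      rw [excess_insert G hwTS, this, ih2]
      simp

variable {G}

-- An exchange argument: `T ∪ Y.erase x` is connected with the excess of `Y.erase x`. If `T` is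
-- empty, this excess is at most that of `Y` and the set is smaller; if `x` has degree at least two,
-- the excess is strictly smaller. Either way it cannot dominate, and a vertex it misses is the
-- required `p`.
open Finset in
theorem IsOptimal.exists_isPrivate {Y : Finset V} (hY : IsOptimal G Y) {x : V} (hx : x ∈ Y)
    (hconn : ConnOn G ((Y.erase x : Finset V) : Set V)) (T : Finset V)
    (hind : ∀ w ∈ T, ∀ w' ∈ T, ¬ G.Adj w w')
    (hpriv : ∀ w ∈ T, ∃ z ∈ Y, z ≠ x ∧ IsPrivate G Y z w)
    (hdeg : T = ∅ ∨ ∃ y ∈ Y, ∃ z ∈ Y, y ≠ z ∧ G.Adj x y ∧ G.Adj x z) :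
    ∃ p, IsPrivate G Y x p ∧ ∀ w ∈ T, ¬ G.Adj p w := by
  obtain ⟨c1, c2⟩ := connOn_union_excess G hconn T hind
    (fun w hw hwY => by
      obtain ⟨z, -, -, hz⟩ := hpriv w hw
      exact hz.1 (mem_of_mem_erase hwY))
    (fun w hw => by
      obtain ⟨z, hzY, hzx, hz⟩ := hpriv w hw
      exact ⟨z, mem_erase.2 ⟨hzx, hzY⟩, hz.2.1.symm, fun z' hz' h =>
        hz.2.2 z' (mem_of_mem_erase hz') h.symm⟩)
  obtain ⟨y0, hy0⟩ := hconn.1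
  have hy0 := mem_erase.1 (mem_coe.1 hy0)
  obtain ⟨x', hx'Y, hx'x, hxx'⟩ := hY.1.1.exists_adj (x := x) (y := y0) hx hy0.2 hy0.1
  have hx'Y : x' ∈ Y := hx'Y
  have hE := excess_insert G (notMem_erase x Y)
  rw [insert_erase hx] at hE
  have hd1 : 1 ≤ #{w ∈ Y.erase x | G.Adj x w} :=
    card_pos.2 ⟨x', by simp [hx'x, hx'Y, hxx']⟩
  have hnd : ¬ IsConnDom G (T ∪ Y.erase x) := by
    intro hcd
    obtain ⟨o1, o2⟩ := hY.2 _ hcd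
    rw [c2] at o1 o2
    rcases hdeg with rfl | ⟨y, hy, z, hz, hyz, hxy, hxz⟩
    · have h1 : excess G (Y.erase x) = excess G Y := by omega
      have h2 := o2 h1
      rw [empty_union, card_erase_of_mem hx] at h2
      have := card_pos.2 ⟨x, hx⟩
      omega
    · have : 2 ≤ #{w ∈ Y.erase x | G.Adj x w} := by
        rw [← card_pair hyz]
        apply card_le_card
        intro u hu
        simp only [mem_insert, mem_singleton] at hu
        rcases hu with rfl | rfl
        · simp [hy, hxy, hxy.ne']
        · simp [hz, hxz, hxz.ne']
      omega
  simp only [IsConnDom, not_and, not_forall, not_exists] at hnd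
  obtain ⟨p, hpn, hp⟩ := hnd c1
  have hpn' : p ∉ T ∧ p ∉ Y.erase x := by simpa only [mem_union, not_or] using hpn
  have hpx : p ≠ x := by
    rintro rfl
    exact hp x' (mem_union_right _ (mem_erase.2 ⟨hx'x, hx'Y⟩)) hxx'
  have hpY : p ∉ Y := fun h => hpn'.2 (mem_erase.2 ⟨hpx, h⟩)
  have key : ∀ y ∈ Y, G.Adj y p → y = x := by
    intro y hy hyp
    by_contra hne
    exact hp y (mem_union_right _ (mem_erase.2 ⟨hne, hy⟩)) hyp.symm
  obtain ⟨d, hd, hpd⟩ := hY.1.2 p hpY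
  have hdx := key d hd hpd.symm
  subst hdx
  exact ⟨p, ⟨hpY, hpd.symm, key⟩, fun w hw h => hp w (mem_union_left _ hw) h⟩

end Finite

/-! ### Growing leaves on an induced subgraph inside an optimal set. -/

/-- `p` is a neighbour of the cut vertex `f x` of `G[Y]` that `f x` separates from the images of
the other vertices. -/
def IsSeparated (G : SimpleGraph V) (Y : Finset V) (f : W → V) (x : W) (p : V) : Prop :=
  p ∈ Y ∧ p ≠ f x ∧ G.Adj (f x) p ∧ ∃ C : Set V, (∀ y, y ≠ x → f y ∈ C) ∧ f x ∉ C ∧ p ∉ C ∧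
    ∀ q ∈ Y, q ≠ f x → q ∉ C → ∀ c ∈ C, ¬ G.Adj c q

/-- `p` can serve as a leaf attached to `f x`. -/
def IsExt (G : SimpleGraph V) (Y : Finset V) (f : W → V) (x : W) (p : V) : Prop :=
  IsPrivate G Y (f x) p ∨ IsSeparated G Y f x p

section

variable {G : SimpleGraph V} {Y : Finset V} {f : W → V} {x z : W} {p q : V}

theorem IsExt.adj (h : IsExt G Y f x p) : G.Adj (f x) p :=
  h.elim (fun h => h.2.1) fun h => h.2.2.1

theorem IsExt.not_adj (h : IsExt G Y f x p) (hf : ∀ x, f x ∈ Y) (hinj : Function.Injective f)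
    (hzx : z ≠ x) : ¬ G.Adj (f z) p := by
  rcases h with h | ⟨h1, h2, h3, C, h4, h5, h6, h7⟩
  · exact fun hz => hzx (hinj (h.2.2 _ (hf z) hz))
  · exact h7 p h1 h2 h6 _ (h4 z hzx)

theorem IsExt.ne (h : IsExt G Y f x p) (hf : ∀ x, f x ∈ Y) (z : W) : p ≠ f z := by
  rintro rfl
  rcases h with h | ⟨h1, h2, h3, C, h4, h5, h6, h7⟩
  · exact h.1 (hf z)
  · by_cases hzx : z = x
    · exact h2 (by rw [hzx])
    · exact h6 (h4 z hzx)

/-- Only two private leaves can be adjacent. A separated `p` lies in `Y` and beyond the cut at `f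
x`, whereas a leaf at `f z` either has `f z` as its only neighbour in `Y` or lies on the side of `f
z`. -/
theorem IsSeparated.not_adj_of_isExt (h : IsSeparated G Y f x p) (h' : IsExt G Y f z q)
    (hxz : x ≠ z) : ¬ G.Adj p q := by
  intro hpq
  obtain ⟨h1, h2, h3, C, h4, h5, h6, h7⟩ := h
  rcases h' with h' | ⟨k1, k2, k3, D, k4, k5, k6, k7⟩
  · have := h'.2.2 p h1 hpq
    exact h6 (this ▸ h4 z hxz.symm)
  · by_cases hqC : q ∈ C
    · exact h7 p h1 h2 h6 q hqC hpq.symm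
    · refine h7 q k1 (fun h => ?_) hqC _ (h4 z hxz.symm) k3
      exact k6 (h ▸ k4 x hxz)

/-- Since `H - x` is connected, the rest of the copy lies on one side of a cut of `G[Y] - f x`.
Since `G[Y]` is connected, the other side contains a neighbour of `f x`. -/
theorem exists_isSeparated [DecidableEq V] {H : SimpleGraph W} (f : H ↪g G)
    (hf : ∀ x, f x ∈ Y) (hY : ConnOn G (Y : Set V)) (hx : ConnOn H {x}ᶜ)
    (hn : ¬ ConnOn G ((Y.erase (f x) : Finset V) : Set V)) : ∃ p, IsSeparated G Y f x p := by
  have hfm : ∀ y, y ≠ x → f y ∈ Y.erase (f x) := fun y hy =>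
    Finset.mem_erase.2 ⟨fun h => hy (f.injective h), hf y⟩
  obtain ⟨y0, hy0⟩ := hx.1
  have hy0 : y0 ≠ x := hy0
  simp only [ConnOn, not_and, not_forall, not_exists] at hn
  obtain ⟨A, hA, hA1, hA2, hcross⟩ := hn ⟨f y0, hfm y0 hy0⟩
  have hcross : ∀ a ∈ A, ∀ b ∈ Y.erase (f x), b ∉ A → ¬ G.Adj a b := fun a ha b hb hbA =>
    hcross a ha b ⟨hb, hbA⟩
  -- `C` is whichever of `A` and its complement contains the rest of the copy.
  obtain ⟨C, hC, hC1, hC2, hCc⟩ : ∃ C : Set V, C ⊆ Y.erase (f x) ∧ (∀ y, y ≠ x → f y ∈ C) ∧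
      (((Y.erase (f x) : Finset V) : Set V) \ C).Nonempty ∧
      ∀ a ∈ C, ∀ b ∈ Y.erase (f x), b ∉ C → ¬ G.Adj a b := by
    by_cases hall : ∀ y, y ≠ x → f y ∈ A
    · exact ⟨A, hA, hall, hA2, hcross⟩
    · refine ⟨((Y.erase (f x) : Finset V) : Set V) \ A, Set.sdiff_subset, ?_, ?_, ?_⟩
      · intro y hy
        refine ⟨hfm y hy, fun hyA => ?_⟩
        push Not at hall
        obtain ⟨z, hz, hzA⟩ := hall
        obtain ⟨a, ha, b, hb, hab⟩ := hx.2 {u | u ≠ x ∧ f u ∈ A} (fun u hu => hu.1)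
          ⟨y, hy, hyA⟩ ⟨z, hz, fun h => hzA h.2⟩
        have hbx : b ≠ x := hb.1
        exact hcross _ ha.2 _ (hfm b hbx) (fun h => hb.2 ⟨hbx, h⟩) (f.map_adj_iff.2 hab)
      · obtain ⟨a, ha⟩ := hA1
        exact ⟨a, hA ha, fun h => h.2 ha⟩
      · intro a ha b hb hb' hab
        have hbA : b ∈ A := by
          by_contra h
          exact hb' ⟨hb, h⟩
        exact hcross b hbA a ha.1 ha.2 hab.symm
  obtain ⟨p0, hp0, hp0C⟩ := hC2
  obtain ⟨p, ⟨hp, hpC⟩, d, ⟨hdY, hd⟩, hpd⟩ := hY.2 (((Y.erase (f x) : Finset V) : Set V) \ C)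
    (fun v hv => Finset.mem_of_mem_erase hv.1) ⟨p0, hp0, hp0C⟩
    ⟨f x, hf x, fun h => Finset.notMem_erase _ _ h.1⟩
  have hp := Finset.mem_erase.1 (Finset.mem_coe.1 hp)
  have hdx : d = f x := by
    by_contra hdx
    have hdm : d ∈ Y.erase (f x) := Finset.mem_erase.2 ⟨hdx, hdY⟩
    have hdC : d ∈ C := by
      by_contra h
      exact hd ⟨hdm, h⟩
    exact hCc d hdC p (Finset.mem_erase.2 hp) hpC hpd.symm
  subst hdx
  exact ⟨p, hp.2, hp.1, hpd.symm, C, hC1, fun h => Finset.notMem_erase _ _ (hC h), hpC,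
    fun q hq hqx hqC c hc => hCc c hc q (Finset.mem_erase.2 ⟨hqx, hq⟩) hqC⟩

end

section

variable [DecidableEq V] {G : SimpleGraph V} [DecidableRel G.Adj] {Y : Finset V}
  {H : SimpleGraph W}

theorem IsOptimal.exists_isExt (hY : IsOptimal G Y) (f : H ↪g G) (hf : ∀ x, f x ∈ Y) {x : W}
    (hx : ConnOn H {x}ᶜ) : ∃ p, IsExt G Y f x p := by
  by_cases hc : ConnOn G ((Y.erase (f x) : Finset V) : Set V)
  · obtain ⟨p, hp, -⟩ := hY.exists_isPrivate (hf x) hc ∅ (by simp) (by simp) (Or.inl rfl)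
    exact ⟨p, Or.inl hp⟩
  · obtain ⟨p, hp⟩ := exists_isSeparated f hf hY.1.1 hx hc
    exact ⟨p, Or.inr hp⟩

/-- If at most one of the vertices in `M` has degree less than two, then leaves for all vertices
in `M` can be chosen independently. -/
theorem IsOptimal.attachLeaves_isIndContained [Finite W] (hY : IsOptimal G Y) (f : H ↪g G)
    (hf : ∀ x, f x ∈ Y) {M : Set W} {x₀ : W} (hx₀ : x₀ ∈ M) (hM : ∀ x ∈ M, ConnOn H {x}ᶜ)
    (hdeg : ∀ x ∈ M, x ≠ x₀ → ∃ y z, y ≠ z ∧ H.Adj x y ∧ H.Adj x z) :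
    (attachLeaves H M).IsIndContained G := by
  classical
  -- Leaves are chosen one vertex at a time. The exceptional `x₀` comes first: no earlier leaf has
  -- to be avoided there, so no degree bound is needed.
  have key : ∀ N : Finset W, x₀ ∉ N → (∀ x ∈ N, x ∈ M) → ∃ g : W → V,
      (∀ x ∈ insert x₀ N, IsExt G Y f x (g x)) ∧
        ∀ x ∈ insert x₀ N, ∀ z ∈ insert x₀ N, ¬ G.Adj (g x) (g z) := by
    intro N hx₀N hN
    induction N using Finset.induction_on with
    | empty =>
      obtain ⟨p, hp⟩ := hY.exists_isExt f hf (hM x₀ hx₀)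
      exact ⟨fun _ => p, by simpa using hp, by simp⟩
    | insert x N hxN ih =>
      have hxx₀ : x ≠ x₀ := fun h => hx₀N (by simp [h])
      have hxM : x ∈ M := hN x (by simp)
      obtain ⟨g, hg1, hg2⟩ := ih (fun h => hx₀N (Finset.mem_insert_of_mem h))
        (fun z hz => hN z (Finset.mem_insert_of_mem hz))
      have hxN' : x ∉ insert x₀ N := by simp [hxx₀, hxN]
      obtain ⟨p, hp, hpg⟩ : ∃ p, IsExt G Y f x p ∧ ∀ z ∈ insert x₀ N, ¬ G.Adj p (g z) := by
        by_cases hc : ConnOn G ((Y.erase (f x) : Finset V) : Set V)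
        · have hpriv : ∀ z ∈ insert x₀ N, g z ∉ Y → IsPrivate G Y (f z) (g z) :=
            fun z hz hzY => (hg1 z hz).resolve_right fun h => hzY h.1
          obtain ⟨y, z, hyz, hxy, hxz⟩ := hdeg x hxM hxx₀
          -- Only leaves outside `Y` enter the exchange; those inside `Y` are separated and avoid
          -- `p` automatically.
          obtain ⟨p, hp, hpT⟩ := hY.exists_isPrivate (hf x) hc
            (((insert x₀ N).filter fun z => g z ∉ Y).image g)
            (by
              simp only [Finset.mem_image, Finset.mem_filter]
              rintro _ ⟨a, ⟨ha, -⟩, rfl⟩ _ ⟨b, ⟨hb, -⟩, rfl⟩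
              exact hg2 a ha b hb)
            (by
              simp only [Finset.mem_image, Finset.mem_filter]
              rintro _ ⟨a, ⟨ha, haY⟩, rfl⟩
              refine ⟨f a, hf a, fun h => hxN' ?_, hpriv a ha haY⟩
              rwa [← f.injective h])
            (Or.inr ⟨f y, hf y, f z, hf z, fun h => hyz (f.injective h),
              f.map_adj_iff.2 hxy, f.map_adj_iff.2 hxz⟩)
          refine ⟨p, Or.inl hp, fun z hz => ?_⟩
          rcases hg1 z hz with h | h
          · exact hpT _ (Finset.mem_image_of_mem g (Finset.mem_filter.2 ⟨hz, h.1⟩))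
          · exact fun hadj => h.not_adj_of_isExt (Or.inl hp) (fun h : z = x => hxN' (h ▸ hz)) hadj.symm
        · obtain ⟨p, hp⟩ := exists_isSeparated f hf hY.1.1 (hM x hxM) hc
          exact ⟨p, Or.inr hp, fun z hz =>
            hp.not_adj_of_isExt (hg1 z hz) (fun h : x = z => hxN' (h ▸ hz))⟩
      have hup : ∀ z ∈ insert x₀ N, Function.update g x p z = g z := fun z hz =>
        Function.update_of_ne (fun h : z = x => hxN' (h ▸ hz)) _ _
      rw [Finset.insert_comm]
      refine ⟨Function.update g x p, fun z hz => ?_, fun z hz w hw => ?_⟩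
      · rcases Finset.mem_insert.1 hz with rfl | hz
        · simpa using hp
        · rw [hup z hz]
          exact hg1 z hz
      · rcases Finset.mem_insert.1 hz with rfl | hz' <;>
          rcases Finset.mem_insert.1 hw with rfl | hw'
        · exact G.irrefl
        · rw [Function.update_self, hup w hw']
          exact hpg w hw'
        · rw [Function.update_self, hup z hz']
          exact fun h => hpg z hz' h.symm
        · rw [hup z hz', hup w hw']
          exact hg2 z hz' w hw'
  obtain ⟨g, hg1, hg2⟩ := key (M.toFinite.toFinset.erase x₀) (Finset.notMem_erase _ _)
    (fun x hx => by simpa using Finset.mem_of_mem_erase hx)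
  rw [Finset.insert_erase (by simpa using hx₀)] at hg1 hg2
  have hg1 : ∀ x ∈ M, IsExt G Y f x (g x) := by simpa using hg1
  have hg2 : ∀ x ∈ M, ∀ z ∈ M, ¬ G.Adj (g x) (g z) := by simpa using hg2
  have hgadj : ∀ x, ∀ z ∈ M, G.Adj (f x) (g z) ↔ x = z := fun x z hz =>
    ⟨fun h => by
      by_contra hxz
      exact (hg1 z hz).not_adj hf f.injective hxz h, fun h => h ▸ (hg1 z hz).adj⟩
  refine ⟨⟨⟨Sum.elim f fun u => g u.1, ?_⟩, ?_⟩⟩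
  · rintro (a | a) (b | b) hab
    · exact congrArg _ (f.injective hab)
    · exact absurd hab.symm ((hg1 b.1 b.2).ne hf a)
    · exact absurd hab ((hg1 a.1 a.2).ne hf b)
    · have hab : g a.1 = g b.1 := hab
      have := (hgadj a.1 b.1 b.2).1 (hab ▸ (hg1 a.1 a.2).adj)
      exact congrArg _ (Subtype.ext this)
  · rintro (a | a) (b | b)
    · exact f.map_adj_iff
    · exact hgadj a b.1 b.2
    · exact (G.adj_comm _ _).trans ((hgadj b a.1 a.2).trans eq_comm)
    · exact iff_of_false (hg2 a.1 a.2 b.1 b.2) id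

end

/-! ### Split graphs and 2K₂ in connected graphs. -/

open Finset in
/-- A finite graph without induced `2K₂`, `C₄` and `C₅` is split. -/
theorem isSplit_of_forbidden [Finite V] {G : SimpleGraph V}
    (h2 : ∀ a b c d, G.Adj a b → G.Adj c d →
      ¬ G.Adj a c → ¬ G.Adj a d → ¬ G.Adj b c → ¬ G.Adj b d → False)
    (h4 : ∀ a b c d, G.Adj a b → G.Adj b c → G.Adj c d → G.Adj d a →
      a ≠ c → b ≠ d → ¬ G.Adj a c → ¬ G.Adj b d → False)
    (h5 : ∀ a b c d e, G.Adj a b → G.Adj b c → G.Adj c d → G.Adj d e → G.Adj e a →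
      ¬ G.Adj a c → ¬ G.Adj a d → ¬ G.Adj b d → ¬ G.Adj b e → ¬ G.Adj c e → False) :
    IsSplit G := by
  classical
  have := Fintype.ofFinite V
  obtain ⟨K₀, hK₀, hmax₀⟩ := exists_max_image
    (univ.filter fun K : Finset V => G.IsClique (K : Set V)) card ⟨∅, by simp⟩
  -- Among maximum cliques, `K` has the largest degree sum; the stable part will be its complement.
  obtain ⟨K, hK, hmax⟩ := exists_max_image
    (univ.filter fun K : Finset V => G.IsClique (K : Set V) ∧ K.card = K₀.card)
    (fun K => ∑ v ∈ K, G.degree v) ⟨K₀, by simpa using hK₀⟩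
  simp only [mem_filter, mem_univ, true_and] at hK₀ hmax₀ hK hmax
  obtain ⟨hKc, hKcard⟩ := hK
  rw [← hKcard] at hmax₀ hmax
  clear hKcard hK₀ K₀
  have hext : ∀ x, x ∉ K → ∃ a ∈ K, ¬ G.Adj x a := by
    intro x hx
    by_contra! h
    have := hmax₀ (insert x K) (by
      rw [coe_insert]
      exact hKc.insert fun b hb _ => h b hb)
    rw [card_insert_of_notMem hx] at this
    omega
  have hKadj : ∀ a ∈ K, ∀ b ∈ K, a ≠ b → G.Adj a b := fun a ha b hb hab => hKc ha hb hab
  have main : ∀ x y, x ∉ K → y ∉ K → G.Adj x y →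
      (∀ a ∈ K, ¬ G.Adj x a → ¬ G.Adj y a) → False := by
    intro x y hx hy hxy hsub
    obtain ⟨z, hz, hxz⟩ := hext x hx
    have hyz := hsub z hz hxz
    have huniq : ∀ a ∈ K, a ≠ z → G.Adj x a := by
      intro a ha haz
      by_contra hxa
      exact h2 x y a z hxy (hKadj a ha z hz haz) hxa hxz (hsub a ha hxa) hyz
    have hcl : G.IsClique ((insert x (K.erase z) : Finset V) : Set V) := by
      rw [coe_insert]
      refine (hKc.subset (by simp)).insert fun b hb _ => ?_
      have hb := mem_erase.1 (mem_coe.1 hb)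
      exact huniq b hb.2 hb.1
    have hxe : x ∉ K.erase z := fun h => hx (mem_of_mem_erase h)
    have hcard : (insert x (K.erase z)).card = K.card := by
      rw [card_insert_of_notMem hxe, card_erase_add_one hz]
    obtain ⟨w, hw, hyw⟩ : ∃ w ∈ insert x (K.erase z), ¬ G.Adj y w := by
      by_contra! h
      have hy' : y ∉ insert x (K.erase z) := by
        simp [hxy.ne', hy]
      have := hmax₀ (insert y (insert x (K.erase z))) (by
        rw [coe_insert]
        exact hcl.insert fun b hb _ => h b hb)
      rw [card_insert_of_notMem hy', hcard] at this
      omega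
    have hwx : w ≠ x := fun h => hyw (h ▸ hxy.symm)
    have hw := mem_erase.1 ((mem_insert.1 hw).resolve_left hwx)
    have hxw := huniq w hw.2 hw.1
    have hwz := hKadj w hw.2 z hz hw.1
    -- Swapping `z` for `x` gives another maximum clique, so the degree of `x` is at most that of
    -- `z`. As `y` is adjacent to `x` but not to `z`, some `v` is adjacent to `z` but not to `x`.
    have hdeg := hmax _ ⟨hcl, hcard⟩
    rw [sum_insert hxe, ← add_sum_erase K _ hz] at hdeg
    obtain ⟨v, hv, hv'⟩ : ∃ v ∈ G.neighborFinset z, v ∉ G.neighborFinset x := by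
      by_contra! h
      have hss : G.neighborFinset z ⊂ G.neighborFinset x :=
        (ssubset_iff_of_subset h).2 ⟨y, by simpa using hxy, by simpa [G.adj_comm] using hyz⟩
      have := card_lt_card hss
      simp only [G.card_neighborFinset_eq_degree] at this
      omega
    have hzv : G.Adj z v := by simpa using hv
    have hxv : ¬ G.Adj x v := by simpa using hv'
    have hyv : G.Adj y v := by
      by_contra hyv
      exact h2 x y z v hxy hzv hxz hxv hyz hyv
    by_cases hwv : G.Adj w v
    · exact h4 x w v y hxw hwv hyv.symm hxy.symm (fun h => hxz (h ▸ hzv.symm))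
        (fun h => hy (h ▸ hw.2)) hxv (fun h => hyw h.symm)
    · exact h5 x w z v y hxw hwz hzv hyv.symm hxy.symm hxz hxv hwv (fun h => hyw h.symm)
        (fun h => hyz h.symm)
  refine ⟨{v | v ∉ K}, K, ?_, ?_, ?_, hKc⟩
  · rw [Set.disjoint_left]
    exact fun v hv hv' => hv hv'
  · ext v
    simp [em']
  · intro x hx y hy _ hxy
    by_cases h : ∀ a ∈ K, ¬ G.Adj x a → ¬ G.Adj y a
    · exact main x y hx hy hxy h
    · by_cases h' : ∀ a ∈ K, ¬ G.Adj y a → ¬ G.Adj x a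
      · exact main y x hy hx hxy.symm h'
      · push Not at h h'
        obtain ⟨a, ha, hxa, hya⟩ := h
        obtain ⟨b, hb, hyb, hxb⟩ := h'
        have hab : a ≠ b := by
          rintro rfl
          exact hxa hxb
        exact h4 x b a y hxb (hKadj b hb a ha hab.symm) hya.symm hxy.symm
          (fun h => hx (h ▸ ha)) (fun h => hy (h ▸ hb)) hxa (fun h => hyb h.symm)

/-- In a connected graph, two edges inducing `2K₂` can be chosen so that some vertex is adjacent
to both of them. -/
theorem exists_twoK2_adj {G : SimpleGraph V} {s : Set V} (hs : ConnOn G s) {a b c d : V}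
    (ha : a ∈ s) (hc : c ∈ s) (hd : d ∈ s) (hcd : G.Adj c d) (hab : G.Adj a b)
    (hac : ¬ G.Adj a c) (had : ¬ G.Adj a d) (hbc : ¬ G.Adj b c) (hbd : ¬ G.Adj b d) :
    ∃ x ∈ s, ∃ y ∈ s, ∃ z ∈ s, G.Adj y z ∧ ¬ G.Adj a y ∧ ¬ G.Adj a z ∧ ¬ G.Adj b y ∧
      ¬ G.Adj b z ∧ G.Adj x y ∧ (G.Adj x a ∨ G.Adj x b) := by
  -- The set consists of the ends of edges that form a 2K₂ with `ab`. An edge `yx` of `G` leaves it;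
  -- were `x` nonadjacent to `a` and `b`, then `xy` would put `x` in the set.
  obtain ⟨y, ⟨hy, hay, hby, z, hz, hyz, haz, hbz⟩, x, ⟨hx, hxn⟩, hyx⟩ :=
    hs.2 {y | y ∈ s ∧ ¬ G.Adj a y ∧ ¬ G.Adj b y ∧
      ∃ z ∈ s, G.Adj y z ∧ ¬ G.Adj a z ∧ ¬ G.Adj b z} (fun y hy => hy.1)
      ⟨c, hc, hac, hbc, d, hd, hcd, had, hbd⟩ ⟨a, ha, fun h => h.2.2.1 hab.symm⟩
  refine ⟨x, hx, y, hy, z, hz, hyz, hay, haz, hby, hbz, hyx.symm, ?_⟩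
  by_contra! h
  exact hxn ⟨hx, fun h' => h.1 h'.symm, fun h' => h.2 h'.symm, y, hy, hyx.symm, hay, hby⟩

/-! ### Decidable checks on the small graphs. -/

instance : DecidableRel H1.Adj := inferInstanceAs (DecidableRel (SimpleGraph.fromEdgeSet _).Adj)
instance : DecidableRel H2.Adj := inferInstanceAs (DecidableRel (SimpleGraph.fromEdgeSet _).Adj)

instance (n : ℕ) : DecidableRel (SimpleGraph.pathGraph n).Adj := fun _ _ =>
  decidable_of_iff _ SimpleGraph.pathGraph_adj.symm

/-- Replacing vertex sets by Boolean colourings makes the cut condition on a concrete graph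
accessible to `decide`. -/
theorem connOn_of_coloring {H : SimpleGraph W} {s : Set W} (hs : s.Nonempty)
    (h : ∀ c : W → Bool, (∀ i ∈ s, ∀ j ∈ s, H.Adj i j → c i = true → c j = true) →
      ∀ i ∈ s, ∀ j ∈ s, c i = true → c j = true) : ConnOn H s := by
  classical
  refine ⟨hs, ?_⟩
  rintro A hA ⟨a, ha⟩ ⟨b, hb, hbA⟩
  by_contra! hn
  have := h (fun v => decide (v ∈ A)) (fun i hi j hj hij hiA => by
    by_contra hjA
    exact hn i (by simpa using hiA) j ⟨hj, by simpa using hjA⟩ hij) a (hA ha) b hb (by simpa using ha)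
  exact hbA (by simpa using this)

/-- An embedding of a graph on `Fin n`, from the adjacencies of an enumeration of its image. -/
def embeddingOfAdj {n : ℕ} {H : SimpleGraph (Fin n)} {G : SimpleGraph V} (f : Fin n → V)
    (h : ∀ i j, i < j → (G.Adj (f i) (f j) ↔ H.Adj i j))
    (hne : ∀ i j, i < j → (∀ k, H.Adj i k ↔ H.Adj j k) → f i ≠ f j) : H ↪g G :=
  have h' : ∀ i j, G.Adj (f i) (f j) ↔ H.Adj i j := fun i j => by
    rcases lt_trichotomy i j with h' | rfl | h'
    · exact h i j h'
    · simp
    · rw [G.adj_comm, H.adj_comm]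
      exact h j i h'
  { toFun := f
    inj' := fun i j hij => by
      -- Indices with equal images have equal neighbourhoods, so distinctness has to be supplied
      -- only for such twins; among the graphs used here, only C₄ has them.
      have htwin : ∀ k, H.Adj i k ↔ H.Adj j k := fun k => by
        rw [← h' i k, ← h' j k, hij]
      rcases lt_trichotomy i j with hlt | hlt | hlt
      · exact absurd hij (hne i j hlt htwin)
      · exact hlt
      · exact absurd hij.symm (hne j i hlt fun k => (htwin k).symm)
    map_rel_iff' := fun {i j} => h' i j }

theorem connOn_H1 {x : Fin 5} (hx : x ∈ ({1, 2, 4} : Set (Fin 5))) : ConnOn H1 {x}ᶜ := by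
  refine connOn_of_coloring ⟨x + 1, by revert x; decide⟩ ?_
  revert x
  simp only [Set.mem_compl_iff, Set.mem_singleton_iff]
  decide

theorem connOn_H2 {x : Fin 5} (hx : x ∈ ({1, 2, 3, 4} : Set (Fin 5))) : ConnOn H2 {x}ᶜ := by
  refine connOn_of_coloring ⟨x + 1, by revert x; decide⟩ ?_
  revert x
  simp only [Set.mem_compl_iff, Set.mem_singleton_iff]
  decide

theorem connOn_cycleGraph_five (x : Fin 5) : ConnOn (SimpleGraph.cycleGraph 5) {x}ᶜ := by
  refine connOn_of_coloring ⟨x + 1, by revert x; decide⟩ ?_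
  revert x
  simp only [Set.mem_compl_iff, Set.mem_singleton_iff]
  decide

theorem connOn_cycleGraph_four (x : Fin 4) : ConnOn (SimpleGraph.cycleGraph 4) {x}ᶜ := by
  refine connOn_of_coloring ⟨x + 1, by revert x; decide⟩ ?_
  revert x
  simp only [Set.mem_compl_iff, Set.mem_singleton_iff]
  decide

theorem connOn_pathGraph_five {x : Fin 5} (hx : x = 0 ∨ x = 4) :
    ConnOn (SimpleGraph.pathGraph 5) {x}ᶜ := by
  refine connOn_of_coloring ⟨x + 1, by revert x; decide⟩ ?_
  revert x
  simp only [Set.mem_compl_iff, Set.mem_singleton_iff]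
  decide

/-! ### Subgraphs excluded from an optimal set. -/

section

variable [DecidableEq V] {G : SimpleGraph V} [DecidableRel G.Adj] {Y : Finset V}

theorem IsOptimal.not_cycleGraph_five (hY : IsOptimal G Y) (hG : IsFree G Q1)
    (f : SimpleGraph.cycleGraph 5 ↪g G) : ¬ ∀ i, f i ∈ Y := fun hf =>
  hG (hY.attachLeaves_isIndContained f hf (Set.mem_univ 0) (fun x _ => connOn_cycleGraph_five x)
    (by decide))

theorem IsOptimal.not_cycleGraph_four (hY : IsOptimal G Y) (hG : IsFree G Q2)
    (f : SimpleGraph.cycleGraph 4 ↪g G) : ¬ ∀ i, f i ∈ Y := fun hf =>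
  hG (hY.attachLeaves_isIndContained f hf (Set.mem_univ 0) (fun x _ => connOn_cycleGraph_four x)
    (by decide))

theorem IsOptimal.not_H1 (hY : IsOptimal G Y) (hG : IsFree G Q3) (f : H1 ↪g G) :
    ¬ ∀ i, f i ∈ Y := fun hf =>
  -- Vertex `4` has degree one in `H1`, so it must be the exceptional vertex.
  hG (hY.attachLeaves_isIndContained f hf (x₀ := 4) (by simp) (fun _ hx => connOn_H1 hx)
    (by decide))

theorem IsOptimal.not_H2 (hY : IsOptimal G Y) (hG : IsFree G Q4) (f : H2 ↪g G) :
    ¬ ∀ i, f i ∈ Y := fun hf =>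
  hG (hY.attachLeaves_isIndContained f hf (x₀ := 4) (by simp) (fun _ hx => connOn_H2 hx)
    (by decide))

/-- Both ends of P₅ have degree one, so their leaves may be adjacent. This is why C₇ is excluded
along with P₇. -/
theorem IsOptimal.not_pathGraph_five (hY : IsOptimal G Y)
    (hP : IsFree G (SimpleGraph.pathGraph 7)) (hC : IsFree G (SimpleGraph.cycleGraph 7))
    (f : SimpleGraph.pathGraph 5 ↪g G) : ¬ ∀ i, f i ∈ Y := by
  intro hf
  obtain ⟨p, hp⟩ := hY.exists_isExt f hf (connOn_pathGraph_five (x := 0) (by simp))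
  obtain ⟨q, hq⟩ := hY.exists_isExt f hf (connOn_pathGraph_five (x := 4) (by simp))
  have hp0 := hp.adj.symm
  have hq4 := hq.adj
  have hpn : ∀ z, z ≠ 0 → ¬ G.Adj p (f z) := fun z hz h => hp.not_adj hf f.injective hz h.symm
  have hqn : ∀ z, z ≠ 4 → ¬ G.Adj (f z) q := fun z hz => hq.not_adj hf f.injective hz
  have hp1 := hpn 1 (by decide)
  have hp2 := hpn 2 (by decide)
  have hp3 := hpn 3 (by decide)
  have hp4 := hpn 4 (by decide)
  have hq0 := hqn 0 (by decide)
  have hq1 := hqn 1 (by decide)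
  have hq2 := hqn 2 (by decide)
  have hq3 := hqn 3 (by decide)
  have hff : ∀ i j, G.Adj (f i) (f j) ↔ (SimpleGraph.pathGraph 5).Adj i j :=
    fun i j => f.map_adj_iff
  by_cases hpq : G.Adj p q
  · refine hC ⟨embeddingOfAdj ![p, f 0, f 1, f 2, f 3, f 4, q] ?_
      fun i j hij h => absurd h (by revert i j; decide)⟩
    intro i j hij
    fin_cases i <;> fin_cases j <;> first
      | exact absurd hij (by decide)
      | exact (hff _ _).trans (by decide)
      | exact iff_of_true (by assumption) (by decide)
      | exact iff_of_false (by assumption) (by decide)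
  · refine hP ⟨embeddingOfAdj ![p, f 0, f 1, f 2, f 3, f 4, q] ?_
      fun i j hij h => absurd h (by revert i j; decide)⟩
    intro i j hij
    fin_cases i <;> fin_cases j <;> first
      | exact absurd hij (by decide)
      | exact (hff _ _).trans (by decide)
      | exact iff_of_true (by assumption) (by decide)
      | exact iff_of_false (by assumption) (by decide)

end

theorem false_of_adj {n : ℕ} {H : SimpleGraph (Fin n)} {G : SimpleGraph V} {Y : Finset V}
    (hH : ∀ f : H ↪g G, ¬ ∀ i, f i ∈ Y) (f : Fin n → V) (hf : ∀ i, f i ∈ Y)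
    (h : ∀ i j, i < j → (G.Adj (f i) (f j) ↔ H.Adj i j))
    (hne : ∀ i j, i < j → (∀ k, H.Adj i k ↔ H.Adj j k) → f i ≠ f j) : False :=
  hH (embeddingOfAdj f h hne) hf

/-- The edges `xb` and `xz` are the only undetermined ones: both give `H2`, exactly one gives `H1`,
neither gives P₅. -/
theorem IsOptimal.not_twoK2_adj [DecidableEq V] {G : SimpleGraph V} [DecidableRel G.Adj]
    {Y : Finset V} (hY : IsOptimal G Y) (hG : IsCFree G) {a b x y z : V} (ha : a ∈ Y) (hb : b ∈ Y)
    (hx : x ∈ Y) (hy : y ∈ Y) (hz : z ∈ Y) (hab : G.Adj a b) (hyz : G.Adj y z)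
    (hay : ¬ G.Adj a y) (haz : ¬ G.Adj a z) (hby : ¬ G.Adj b y) (hbz : ¬ G.Adj b z)
    (hxy : G.Adj x y) (hxa : G.Adj x a) : False := by
  obtain ⟨hP, hC, -, -, hQ3, hQ4⟩ := hG
  by_cases hxb : G.Adj x b <;> by_cases hxz : G.Adj x z
  · refine false_of_adj (hY.not_H2 hQ4) ![x, a, b, y, z]
      (fun i => by fin_cases i <;> assumption) ?_
      fun i j hij h => absurd h (by revert i j; decide)
    intro i j hij
    fin_cases i <;> fin_cases j <;> first
      | exact absurd hij (by decide)
      | exact iff_of_true (by assumption) (by decide)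
      | exact iff_of_false (by assumption) (by decide)
  · refine false_of_adj (hY.not_H1 hQ3) ![x, a, b, y, z]
      (fun i => by fin_cases i <;> assumption) ?_
      fun i j hij h => absurd h (by revert i j; decide)
    intro i j hij
    fin_cases i <;> fin_cases j <;> first
      | exact absurd hij (by decide)
      | exact iff_of_true (by assumption) (by decide)
      | exact iff_of_false (by assumption) (by decide)
  · refine false_of_adj (hY.not_H1 hQ3) ![x, y, z, a, b]
      (fun i => by fin_cases i <;> assumption) ?_
      fun i j hij h => absurd h (by revert i j; decide)
    intro i j hij
    fin_cases i <;> fin_cases j <;> first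
      | exact absurd hij (by decide)
      | exact iff_of_true (by assumption) (by decide)
      | exact iff_of_false (by assumption) (by decide)
      | exact (G.adj_comm _ _).trans (iff_of_false (by assumption) (by decide))
  · refine false_of_adj (hY.not_pathGraph_five hP hC) ![b, a, x, y, z]
      (fun i => by fin_cases i <;> assumption) ?_
      fun i j hij h => absurd h (by revert i j; decide)
    intro i j hij
    fin_cases i <;> fin_cases j <;> first
      | exact absurd hij (by decide)
      | exact iff_of_true (by assumption) (by decide)
      | exact iff_of_false (by assumption) (by decide)
      | exact (G.adj_comm _ _).trans (iff_of_true (by assumption) (by decide))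
      | exact (G.adj_comm _ _).trans (iff_of_false (by assumption) (by decide))

theorem dominatedByConnectedSplit_of_isCFree [Finite V] {G : SimpleGraph V}
    (hconn : ConnOn G Set.univ) (hG : IsCFree G) : DominatedByConnectedSplit G := by
  classical
  obtain ⟨Y, hY⟩ := exists_isOptimal G hconn
  refine ⟨Y, fun v hv => hY.1.2 v hv, connOn_iff.1 hY.1.1, isSplit_of_forbidden ?_ ?_ ?_⟩
  · rintro ⟨a, ha⟩ ⟨b, hb⟩ ⟨c, hc⟩ ⟨d, hd⟩ hab hcd hac had hbc hbd
    obtain ⟨x, hx, y, hy, z, hz, hyz, hay, haz, hby, hbz, hxy, hxa | hxb⟩ :=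
      exists_twoK2_adj hY.1.1 ha hc hd hcd hab hac had hbc hbd
    · exact hY.not_twoK2_adj hG ha hb hx hy hz hab hyz hay haz hby hbz hxy hxa
    · exact hY.not_twoK2_adj hG hb ha hx hy hz hab.symm hyz hby hbz hay haz hxy hxb
  · rintro ⟨a, ha⟩ ⟨b, hb⟩ ⟨c, hc⟩ ⟨d, hd⟩ hab hbc hcd hda hac' hbd' hac hbd
    simp only [SimpleGraph.comap_adj, Function.Embedding.subtype_apply, ne_eq,
      Subtype.mk.injEq] at *
    refine false_of_adj (hY.not_cycleGraph_four hG.2.2.2.1) ![a, b, c, d]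
      (fun i => by fin_cases i <;> assumption) ?_ ?_
    · intro i j hij
      fin_cases i <;> fin_cases j <;> first
        | exact absurd hij (by decide)
        | exact iff_of_true (by assumption) (by decide)
        | exact iff_of_false (by assumption) (by decide)
        | exact (G.adj_comm _ _).trans (iff_of_true (by assumption) (by decide))
    · intro i j hij h
      fin_cases i <;> fin_cases j <;> first
        | exact absurd hij (by decide)
        | exact absurd h (by decide)
        | assumption
  · rintro ⟨a, ha⟩ ⟨b, hb⟩ ⟨c, hc⟩ ⟨d, hd⟩ ⟨e, he⟩ hab hbc hcd hde hea hac had hbd hbe hce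
    simp only [SimpleGraph.comap_adj, Function.Embedding.subtype_apply] at *
    refine false_of_adj (hY.not_cycleGraph_five hG.2.2.1) ![a, b, c, d, e]
      (fun i => by fin_cases i <;> assumption) ?_
      fun i j hij h => absurd h (by revert i j; decide)
    intro i j hij
    fin_cases i <;> fin_cases j <;> first
      | exact absurd hij (by decide)
      | exact iff_of_true (by assumption) (by decide)
      | exact iff_of_false (by assumption) (by decide)
      | exact (G.adj_comm _ _).trans (iff_of_true (by assumption) (by decide))

theorem IsFree.induce {G : SimpleGraph V} {H : SimpleGraph W} (h : IsFree G H) (X : Set V) :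
    IsFree (G.induce X) H := fun ⟨f⟩ =>
  h ⟨(SimpleGraph.Embedding.induce X).comp f⟩

theorem IsCFree.induce {G : SimpleGraph V} (h : IsCFree G) (X : Set V) : IsCFree (G.induce X) :=
  ⟨h.1.induce X, h.2.1.induce X, h.2.2.1.induce X, h.2.2.2.1.induce X, h.2.2.2.2.1.induce X,
    h.2.2.2.2.2.induce X⟩

theorem connOn_univ_iff {G : SimpleGraph V} : ConnOn G Set.univ ↔ G.Connected :=
  connOn_iff.trans (SimpleGraph.induceUnivIso G).connected_iff

/-! ### Necessity: the six graphs have no suitable dominating set. -/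

/-- `D` is a dominating set inducing a graph without isolated vertices (unless `D` is a
singleton), and the part of `K` in `D` is a clique covering all edges inside `D`. -/
structure IsWitness (G : SimpleGraph V) (D K : Set V) : Prop where
  dom : IsDominating G D
  nbr : ∀ x ∈ D, ∀ y ∈ D, y ≠ x → ∃ z ∈ D, G.Adj x z
  cover : ∀ a ∈ D, ∀ b ∈ D, G.Adj a b → a ∈ K ∨ b ∈ K
  clique : ∀ a ∈ D, ∀ b ∈ D, a ∈ K → b ∈ K → a ≠ b → G.Adj a b

theorem DominatedByConnectedSplit.exists_isWitness {G : SimpleGraph V}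
    (h : DominatedByConnectedSplit G) : ∃ D K, IsWitness G D K := by
  obtain ⟨D, hdom, hconn, S, K, -, hSK, hS, hK⟩ := h
  refine ⟨D, Subtype.val '' K, hdom, fun x hx y hy hyx => ?_, fun a ha b hb hab => ?_, ?_⟩
  · obtain ⟨z, hz, -, hxz⟩ := (connOn_iff.2 hconn).exists_adj hx hy hyx
    exact ⟨z, hz, hxz⟩
  · by_contra! hn
    have hmem : ∀ v (hv : v ∈ D), v ∉ Subtype.val '' K → (⟨v, hv⟩ : D) ∈ S := fun v hv hvK =>
      (hSK.symm ▸ Set.mem_univ (⟨v, hv⟩ : D) : _ ∈ S ∪ K).resolve_right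
        fun h => hvK ⟨_, h, rfl⟩
    exact hS (hmem a ha hn.1) (hmem b hb hn.2) (fun h => hab.ne (congrArg Subtype.val h)) hab
  · rintro _ - _ - ⟨a, ha, rfl⟩ ⟨b, hb, rfl⟩ hab
    exact hK ha hb fun h => hab (congrArg Subtype.val h)

/-- The conditions of `IsWitness` transfer along the isomorphism from `H` to the induced copy, so
each obstruction can be examined on its own concrete vertex type. -/
theorem isFree_of_not_isWitness {G : SimpleGraph V} {H : SimpleGraph W} (hH : H.Connected)
    (hn : ∀ D K, ¬ IsWitness H D K)
    (hG : ∀ X : Set V, (G.induce X).Connected → DominatedByConnectedSplit (G.induce X)) :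
    IsFree G H := by
  rintro ⟨f⟩
  obtain ⟨D, K, h⟩ := (hG _ (f.isoInduceRange.connected_iff.1 hH)).exists_isWitness
  set e := f.isoInduceRange
  refine hn (e ⁻¹' D) (e ⁻¹' K) ⟨fun v hv => ?_, fun x hx y hy hyx => ?_,
    fun a ha b hb hab => h.cover _ ha _ hb (e.map_adj_iff.2 hab),
    fun a ha b hb haK hbK hab => e.map_adj_iff.1
      (h.clique _ ha _ hb haK hbK fun h => hab (e.injective h))⟩
  · obtain ⟨d, hd, hvd⟩ := h.dom (e v) hv
    obtain ⟨d, rfl⟩ := e.surjective d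
    exact ⟨d, hd, e.map_adj_iff.1 hvd⟩
  · obtain ⟨z, hz, hxz⟩ := h.nbr _ hx _ hy fun h => hyx (e.injective h)
    obtain ⟨z, rfl⟩ := e.surjective z
    exact ⟨z, hz, e.map_adj_iff.1 hxz⟩

namespace IsWitness

variable {G : SimpleGraph V} {D K : Set V}

theorem exists_adj (h : IsWitness G D K) {x v : V} (hx : x ∈ D) (hvx : v ≠ x)
    (hxv : ¬ G.Adj x v) : ∃ z ∈ D, G.Adj x z := by
  by_cases hv : v ∈ D
  · exact h.nbr x hx v hv hvx
  · obtain ⟨d, hd, hvd⟩ := h.dom v hv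
    exact h.nbr x hx d hd fun h => hxv (h ▸ hvd.symm)

theorem not_twoK2 (h : IsWitness G D K) {a b c d : V} (ha : a ∈ D) (hb : b ∈ D) (hc : c ∈ D)
    (hd : d ∈ D) (hab : G.Adj a b) (hcd : G.Adj c d) (hac : ¬ G.Adj a c) (had : ¬ G.Adj a d)
    (hbc : ¬ G.Adj b c) (hbd : ¬ G.Adj b d) : False := by
  rcases h.cover a ha b hb hab with h1 | h1 <;> rcases h.cover c hc d hd hcd with h2 | h2
  · exact hac (h.clique _ ha _ hc h1 h2 (by rintro rfl; exact hbc hab.symm))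
  · exact had (h.clique _ ha _ hd h1 h2 (by rintro rfl; exact hbd hab.symm))
  · exact hbc (h.clique _ hb _ hc h1 h2 (by rintro rfl; exact hac hab))
  · exact hbd (h.clique _ hb _ hd h1 h2 (by rintro rfl; exact had hab))

theorem not_both (h : IsWitness G D K) {a b : V} (ha : a ∈ D) (hb : b ∈ D) (hab : a ≠ b)
    (hn : ¬ G.Adj a b) : ¬ (a ∈ K ∧ b ∈ K) :=
  fun hK => hn (h.clique a ha b hb hK.1 hK.2 hab)

end IsWitness

theorem connected_attachLeaves {H : SimpleGraph V} (hH : H.Connected) (L : Set V) :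
    (attachLeaves H L).Connected := by
  obtain ⟨x⟩ := hH.nonempty
  let φ : H →g attachLeaves H L := ⟨Sum.inl, fun h => h⟩
  have hinl : ∀ v, (attachLeaves H L).Reachable (Sum.inl x) (Sum.inl v) := fun v =>
    (hH.preconnected x v).map φ
  rw [SimpleGraph.connected_iff_exists_forall_reachable]
  refine ⟨Sum.inl x, ?_⟩
  rintro (v | v)
  · exact hinl v
  · exact (hinl v.1).trans (SimpleGraph.Adj.reachable (show (attachLeaves H L).Adj _ _ from rfl))

/-- Whether the leaf at `u` lies in `D` or not, it needs a neighbour in `D`, and `u` is its only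
neighbour. -/
theorem IsWitness.inl_mem {H : SimpleGraph V} {L : Set V} {D K : Set (V ⊕ L)}
    (h : IsWitness (attachLeaves H L) D K) {u : V} (hu : u ∈ L) {v : V} (hvu : v ≠ u) :
    Sum.inl u ∈ D := by
  have key : ∀ z, (attachLeaves H L).Adj (Sum.inr ⟨u, hu⟩) z → z = Sum.inl u := by
    rintro (z | z) hz
    · exact congrArg _ (Eq.symm hz)
    · exact hz.elim
  by_cases hD : (Sum.inr ⟨u, hu⟩ : V ⊕ L) ∈ D
  · obtain ⟨z, hz, hadj⟩ := h.exists_adj (v := Sum.inl v) hD (by simp)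
      (fun h' => hvu (Sum.inl.inj (key _ h')))
    exact key z hadj ▸ hz
  · obtain ⟨z, hz, hadj⟩ := h.dom _ hD
    exact key z hadj ▸ hz

theorem not_isWitness_pathGraph_seven (D K : Set (Fin 7)) :
    ¬ IsWitness (SimpleGraph.pathGraph 7) D K := by
  intro h
  have h1 : (1 : Fin 7) ∈ D := by
    by_cases h0 : (0 : Fin 7) ∈ D
    · obtain ⟨z, hz, h0z⟩ := h.exists_adj (v := 6) h0 (by decide) (by decide)
      obtain rfl : z = 1 := by clear hz; revert z; decide
      exact hz
    · obtain ⟨z, hz, h0z⟩ := h.dom 0 h0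
      obtain rfl : z = 1 := by clear hz; revert z; decide
      exact hz
  have h5 : (5 : Fin 7) ∈ D := by
    by_cases h6 : (6 : Fin 7) ∈ D
    · obtain ⟨z, hz, h6z⟩ := h.exists_adj (v := 0) h6 (by decide) (by decide)
      obtain rfl : z = 5 := by clear hz; revert z; decide
      exact hz
    · obtain ⟨z, hz, h6z⟩ := h.dom 6 h6
      obtain rfl : z = 5 := by clear hz; revert z; decide
      exact hz
  obtain ⟨z, hz, h1z⟩ := h.exists_adj (v := 5) h1 (by decide) (by decide)
  obtain ⟨w, hw, h5w⟩ := h.exists_adj (v := 1) h5 (by decide) (by decide)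
  exact h.not_twoK2 h1 hz h5 hw h1z h5w (by decide) (by clear hw; revert w; decide)
    (by clear hz; revert z; decide) (by clear hz hw; revert z w; decide)

set_option maxRecDepth 100000 in
theorem not_isWitness_cycleGraph_seven (D K : Set (Fin 7)) :
    ¬ IsWitness (SimpleGraph.cycleGraph 7) D K := by
  classical
  intro h
  -- A set on C₇ in which every vertex has a neighbour contains the two edges of some 2K₂, at `i, i
  -- + 1` and `i + 3, i + 4`.
  have comb : ∀ c : Fin 7 → Bool, (∀ v, c v = false → c (v + 1) = true ∨ c (v - 1) = true) →
      (∀ v, c v = true → c (v + 1) = true ∨ c (v - 1) = true) →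
      ∃ i, c i = true ∧ c (i + 1) = true ∧ c (i + 3) = true ∧ c (i + 4) = true := by
    decide
  have hadj : ∀ v z : Fin 7, (SimpleGraph.cycleGraph 7).Adj v z → z = v + 1 ∨ z = v - 1 := by
    decide
  have hnbr : ∀ v, ∃ z ∈ D, (SimpleGraph.cycleGraph 7).Adj v z := fun v => by
    by_cases hv : v ∈ D
    · exact h.exists_adj (v := v + 2) hv (by clear hv; revert v; decide) (by clear hv; revert v; decide)
    · exact h.dom v hv
  have hstep : ∀ v, v + 1 ∈ D ∨ v - 1 ∈ D := fun v => by
    obtain ⟨z, hz, hvz⟩ := hnbr v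
    rcases hadj v z hvz with rfl | rfl
    · exact Or.inl hz
    · exact Or.inr hz
  obtain ⟨i, h0, h1, h3, h4⟩ := comb (fun v => decide (v ∈ D)) (fun v _ => by simpa using hstep v)
    (fun v _ => by simpa using hstep v)
  simp only [decide_eq_true_eq] at h0 h1 h3 h4
  exact h.not_twoK2 h0 h1 h3 h4 (by clear * -; revert i; decide) (by clear * -; revert i; decide)
    (by clear * -; revert i; decide) (by clear * -; revert i; decide)
    (by clear * -; revert i; decide) (by clear * -; revert i; decide)

/-- The whole cycle lies in `D`, so `K` would restrict to a clique covering every edge of C₅, which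
does not exist. -/
theorem not_isWitness_Q1 (D K) : ¬ IsWitness Q1 D K := by
  intro h
  have hD : ∀ i : Fin 5, Sum.inl i ∈ D := fun i =>
    h.inl_mem (Set.mem_univ i) (v := i + 1) (by revert i; decide)
  have hc : ∀ i j : Fin 5, (SimpleGraph.cycleGraph 5).Adj i j →
      (Sum.inl i : Fin 5 ⊕ (Set.univ : Set (Fin 5))) ∈ K ∨ Sum.inl j ∈ K :=
    fun i j hij => h.cover _ (hD i) _ (hD j) hij
  have hn : ∀ i j : Fin 5, i ≠ j → ¬ (SimpleGraph.cycleGraph 5).Adj i j →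
      ¬ ((Sum.inl i : Fin 5 ⊕ (Set.univ : Set (Fin 5))) ∈ K ∧ Sum.inl j ∈ K) :=
    fun i j hij hadj => h.not_both (hD i) (hD j) (by simpa using hij) hadj
  have c1 := hc 0 1 (by decide)
  have c2 := hc 1 2 (by decide)
  have c3 := hc 2 3 (by decide)
  have c4 := hc 3 4 (by decide)
  have c5 := hc 4 0 (by decide)
  have n1 := hn 0 2 (by decide) (by decide)
  have n2 := hn 1 3 (by decide) (by decide)
  have n3 := hn 2 4 (by decide) (by decide)
  have n4 := hn 3 0 (by decide) (by decide)
  have n5 := hn 4 1 (by decide) (by decide)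
  tauto

theorem not_isWitness_Q2 (D K) : ¬ IsWitness Q2 D K := by
  intro h
  have hD : ∀ i : Fin 4, Sum.inl i ∈ D := fun i =>
    h.inl_mem (Set.mem_univ i) (v := i + 1) (by revert i; decide)
  have hc : ∀ i j : Fin 4, (SimpleGraph.cycleGraph 4).Adj i j →
      (Sum.inl i : Fin 4 ⊕ (Set.univ : Set (Fin 4))) ∈ K ∨ Sum.inl j ∈ K :=
    fun i j hij => h.cover _ (hD i) _ (hD j) hij
  have hn : ∀ i j : Fin 4, i ≠ j → ¬ (SimpleGraph.cycleGraph 4).Adj i j →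
      ¬ ((Sum.inl i : Fin 4 ⊕ (Set.univ : Set (Fin 4))) ∈ K ∧ Sum.inl j ∈ K) :=
    fun i j hij hadj => h.not_both (hD i) (hD j) (by simpa using hij) hadj
  have c1 := hc 0 1 (by decide)
  have c2 := hc 1 2 (by decide)
  have c3 := hc 2 3 (by decide)
  have c4 := hc 3 0 (by decide)
  have n1 := hn 0 2 (by decide) (by decide)
  have n2 := hn 1 3 (by decide) (by decide)
  tauto

theorem not_isWitness_Q3 (D K) : ¬ IsWitness Q3 D K := by
  intro h
  have h1 := h.inl_mem (u := 1) (by simp) (v := 0) (by decide)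
  have h2 := h.inl_mem (u := 2) (by simp) (v := 0) (by decide)
  have h4 := h.inl_mem (u := 4) (by simp) (v := 0) (by decide)
  -- Vertex `4` has a neighbour in `D`, either `3` or its own leaf; both edges form a 2K₂ with the
  -- edge `12`.
  obtain ⟨z, hz, h4z⟩ := h.exists_adj (v := Sum.inl 1) h4 (by simp)
    (show ¬ H1.Adj 4 1 by decide)
  rcases z with z | z
  · obtain rfl : z = 3 := by
      have h4z' : H1.Adj 4 z := h4z
      clear hz h4z
      revert z
      decide
    exact h.not_twoK2 h1 h2 h4 hz (show H1.Adj 1 2 by decide) h4z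
      (show ¬ H1.Adj 1 4 by decide) (show ¬ H1.Adj 1 3 by decide)
      (show ¬ H1.Adj 2 4 by decide) (show ¬ H1.Adj 2 3 by decide)
  · have h4z' : (4 : Fin 5) = z := h4z
    exact h.not_twoK2 h1 h2 h4 hz (show H1.Adj 1 2 by decide) h4z
      (show ¬ H1.Adj 1 4 by decide) (fun h' => absurd (Eq.trans h' h4z'.symm) (by decide))
      (show ¬ H1.Adj 2 4 by decide) (fun h' => absurd (Eq.trans h' h4z'.symm) (by decide))

theorem not_isWitness_Q4 (D K) : ¬ IsWitness Q4 D K := by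
  intro h
  have h1 := h.inl_mem (u := 1) (by simp) (v := 0) (by decide)
  have h2 := h.inl_mem (u := 2) (by simp) (v := 0) (by decide)
  have h3 := h.inl_mem (u := 3) (by simp) (v := 0) (by decide)
  have h4 := h.inl_mem (u := 4) (by simp) (v := 0) (by decide)
  exact h.not_twoK2 h1 h2 h3 h4 (show H2.Adj 1 2 by decide) (show H2.Adj 3 4 by decide)
    (show ¬ H2.Adj 1 3 by decide) (show ¬ H2.Adj 1 4 by decide)
    (show ¬ H2.Adj 2 3 by decide) (show ¬ H2.Adj 2 4 by decide)

theorem connected_H1 : H1.Connected := by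
  refine connOn_univ_iff.1 (connOn_of_coloring ⟨0, trivial⟩ ?_)
  simp only [Set.mem_univ]
  decide

theorem connected_H2 : H2.Connected := by
  refine connOn_univ_iff.1 (connOn_of_coloring ⟨0, trivial⟩ ?_)
  simp only [Set.mem_univ]
  decide

theorem isCFree_of_dominated {G : SimpleGraph V}
    (hG : ∀ X : Set V, (G.induce X).Connected → DominatedByConnectedSplit (G.induce X)) :
    IsCFree G :=
  ⟨isFree_of_not_isWitness (SimpleGraph.pathGraph_connected 6) not_isWitness_pathGraph_seven hG,
    isFree_of_not_isWitness SimpleGraph.cycleGraph_connected not_isWitness_cycleGraph_seven hG,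
    isFree_of_not_isWitness (connected_attachLeaves SimpleGraph.cycleGraph_connected _)
      not_isWitness_Q1 hG,
    isFree_of_not_isWitness (connected_attachLeaves SimpleGraph.cycleGraph_connected _)
      not_isWitness_Q2 hG,
    isFree_of_not_isWitness (connected_attachLeaves connected_H1 _) not_isWitness_Q3 hG,
    isFree_of_not_isWitness (connected_attachLeaves connected_H2 _) not_isWitness_Q4 hG⟩

end SplitDomination

theorem mainTheorem1 {V : Type*} [Finite V] (G : SimpleGraph V) :
    (∀ X : Set V, (G.induce X).Connected →
        SplitDomination.DominatedByConnectedSplit (G.induce X)) ↔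
      SplitDomination.IsCFree G :=
  ⟨SplitDomination.isCFree_of_dominated, fun hG X hX =>
    SplitDomination.dominatedByConnectedSplit_of_isCFree
      (SplitDomination.connOn_univ_iff.2 hX) (hG.induce X)⟩
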